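/- Let $\mathbb D$, $\mathbb T$, $\mathbb E$ be the open unit disk, the unit circle and the complement of the closed unit disk in $\mathbb C$. Let $\mathfrak p\in\mathbb C[z,w]$ be square free and inner toral, i.e. its zero set satisfies $Z(\mathfrak p)\subset\mathbb D^2\cup\mathbb T^2\cup\mathbb E^2$. Let $S,T$ be commuting pure isometries (isometries without unitary part) on a complex Hilbert space $\mathcal H$ with $\mathfrak p(S,T)=0$, and suppose that $\dim\ker S^*=M$ and $\dim\ker T^*=N$ are finite. Let $L^2_{\mathbb C^M}$ be the space of square integrable $\mathbb C^M$-valued functions on $\mathbb T$ and $H^2_{\mathbb C^M}\subset L^2_{\mathbb C^M}$ the Hardy space, consisting of the functions whose Fourier coefficients of negative index vanish, identified with the analytic functions $f(z)=\sum_{n\ge0}\hat f(n)z^n$ on $\mathbb D$. Then there is an $M\times M$ matrix $\Phi$ of rational functions, with all its (finite) poles in $\mathbb E$, that is inner (analytic and contractive on $\mathbb D$, with unitary radial limits at almost every point of $\mathbb T$), such that the operators $M_z$ and $M_\Phi$ of multiplication by $zI_M$ and $\Phi$ are bounded on $H^2_{\mathbb C^M}$, the operators $J_z$ and $J_\Phi$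 of multiplication by $zI_M$ and $\Phi$ are bounded on $L^2_{\mathbb C^M}$, and the following hold. There is a unitary $U:\mathcal H\to H^2_{\mathbb C^M}$ with $US=M_zU$ and $UT=M_\Phi U$, and $\mathfrak p(M_z,M_\Phi)=0$. Moreover: (i) $J_z$ and $J_\Phi$ are commuting unitary operators; (ii) $J_z$ and $J_\Phi$ map $H^2_{\mathbb C^M}$ into itself, and their restrictions to it are $M_z$ and $M_\Phi$; (iii) $\mathfrak p(\lambda I_M,\Phi(\lambda))=0$ for every $\lambda\in\overline{\mathbb D}$; (iv) $\mathfrak p(J_z,J_\Phi)=0$. -/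

import Mathlib

open MeasureTheory Filter Topology
open scoped ENNReal

noncomputable section

namespace Isopair

/-- The value `q(a, b)` of a polynomial `q ∈ ℂ[z, w]` at a (commuting) pair of elements of a
`ℂ`-algebra, e.g. operators or matrices; variable `0` is `z` and variable `1` is `w`. -/
def polyEval {A : Type*} [Ring A] [Algebra ℂ A] (q : MvPolynomial (Fin 2) ℂ) (a b : A) : A :=
  ∑ m ∈ q.support, q.coeff m • (a ^ m 0 * b ^ m 1)

/-- `Z(q) ⊆ 𝔻² ∪ 𝕋² ∪ 𝔼²`. -/
def InnerToral (q : MvPolynomial (Fin 2) ℂ) : Prop :=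
  ∀ z w : ℂ, MvPolynomial.eval ![z, w] q = 0 →
    (‖z‖ < 1 ∧ ‖w‖ < 1) ∨ (‖z‖ = 1 ∧ ‖w‖ = 1) ∨ (1 < ‖z‖ ∧ 1 < ‖w‖)

section Operators

variable {H : Type*} [NormedAddCommGroup H] [InnerProductSpace ℂ H] [CompleteSpace H]

/-- A pure isometry: an isometry without unitary part, i.e. the only closed reducing subspace
on which it restricts to a unitary (surjective isometry) is the zero subspace. -/
structure IsPureIsometry (V : H →L[ℂ] H) : Prop where
  isometry : Isometry V
  pure : ∀ K : Submodule ℂ H, IsClosed (K : Set H) →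
    (∀ x ∈ K, V x ∈ K) → (∀ x ∈ K, ContinuousLinearMap.adjoint V x ∈ K) →
    (∀ y ∈ K, ∃ x ∈ K, V x = y) → K = ⊥

/-- The multiplicity of an isometry, `dim ker V*`. -/
def mult (V : H →L[ℂ] H) : Cardinal :=
  Module.rank ℂ (ContinuousLinearMap.adjoint V).ker

/-- The bimultiplicity of a pair of isometries. -/
def bimult (S T : H →L[ℂ] H) : Cardinal × Cardinal := (mult S, mult T)

/-- `(S, T)` is a pair of commuting pure isometries annihilated by the square free inner toral
polynomial `p`. (It is not required that `p` divides every annihilating polynomial.) -/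
structure IsPureIsopair (p : MvPolynomial (Fin 2) ℂ) (S T : H →L[ℂ] H) : Prop where
  squarefree : Squarefree p
  innerToral : InnerToral p
  pure_left : IsPureIsometry S
  pure_right : IsPureIsometry T
  commute : Commute S T
  annihilated : polyEval p S T = 0

end Operators

/-- The circle as `ℝ / 2πℤ`. -/
abbrev Circ : Type := AddCircle (2 * Real.pi)

instance : Fact (0 < 2 * Real.pi) := ⟨Real.two_pi_pos⟩

/-- Normalized arc length measure on the circle. -/
abbrev circMeas : Measure Circ := AddCircle.haarAddCircle

/-- The point `e^{it}` of the unit circle in `ℂ`. -/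
def pt (t : Circ) : ℂ := (AddCircle.toCircle t : ℂ)

/-- `L²_{ℂ^M}` of the circle. -/
abbrev L2 (M : ℕ) : Type := Lp (EuclideanSpace ℂ (Fin M)) 2 circMeas

/-- The Hardy space `H²_{ℂ^M}`: the elements of `L²_{ℂ^M}` all of whose Fourier coefficients of
negative index vanish. -/
def Hardy (M : ℕ) : Submodule ℂ (L2 M) where
  carrier := {f | ∀ n : ℤ, n < 0 → fourierCoeff (f : Circ → EuclideanSpace ℂ (Fin M)) n = 0}
  zero_mem' := by
    intro n _
    rw [fourierCoeff_congr_ae (Lp.coeFn_zero _ _ _)]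
    simp [fourierCoeff]
  add_mem' := by
    intro f g hf hg n hn
    rw [fourierCoeff_congr_ae (Lp.coeFn_add f g),
      fourierCoeff.add ((Lp.memLp f).integrable one_le_two) ((Lp.memLp g).integrable one_le_two),
      Pi.add_apply, hf n hn, hg n hn, add_zero]
  smul_mem' := by
    intro c f hf n hn
    rw [fourierCoeff_congr_ae (Lp.coeFn_smul c f), fourierCoeff.const_smul, hf n hn, smul_zero]

/-- The value at `z`, `|z| < 1`, of the analytic function on the disk given by an element of the
Hardy space: `f(z) = ∑ f̂(n) zⁿ`. -/
def discValue {M : ℕ} (f : Hardy M) (z : ℂ) : EuclideanSpace ℂ (Fin M) :=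
  ∑' n : ℕ, z ^ n • fourierCoeff ((f : L2 M) : Circ → EuclideanSpace ℂ (Fin M)) (n : ℤ)

/-- A square matrix acting on `ℂ^M`. -/
def act {M : ℕ} (A : Matrix (Fin M) (Fin M) ℂ) (v : EuclideanSpace ℂ (Fin M)) :
    EuclideanSpace ℂ (Fin M) :=
  WithLp.toLp 2 (A.mulVec (WithLp.ofLp v))

/-- `A` is the operator of multiplication by `F` on `H²_{ℂ^M}`: `(A f)(z) = F(z) f(z)` for all
`z` in the open disk. -/
def IsHardyMul {M : ℕ} (F : ℂ → Matrix (Fin M) (Fin M) ℂ) (A : Hardy M →L[ℂ] Hardy M) : Prop :=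
  ∀ (f : Hardy M) (z : ℂ), ‖z‖ < 1 → discValue (A f) z = act (F z) (discValue f z)

/-- `J` is the operator of multiplication by `F` on `L²_{ℂ^M}`: `(J f)(e^{it}) = F(e^{it}) f(e^{it})`
for almost every `t`. -/
def IsL2Mul {M : ℕ} (F : ℂ → Matrix (Fin M) (Fin M) ℂ) (J : L2 M →L[ℂ] L2 M) : Prop :=
  ∀ f : L2 M, ∀ᵐ t ∂circMeas, J f t = act (F (pt t)) (f t)

/-- The function `z ↦ z I_M`. -/
def coordFun (M : ℕ) (z : ℂ) : Matrix (Fin M) (Fin M) ℂ := Matrix.scalar (Fin M) z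

/-- Inner function: analytic and contractive on the open disk, with unitary radial limits at
almost every point of the circle. -/
structure IsInner {M : ℕ} (F : ℂ → Matrix (Fin M) (Fin M) ℂ) : Prop where
  analytic : ∀ i j, DifferentiableOn ℂ (fun z => F z i j) (Metric.ball 0 1)
  contractive : ∀ z : ℂ, ‖z‖ < 1 → ∀ v, ‖act (F z) v‖ ≤ ‖v‖
  unitary_boundary : ∀ᵐ t ∂circMeas, ∃ W ∈ Matrix.unitaryGroup (Fin M) ℂ,
    Tendsto (fun r : ℝ => F ((r : ℂ) * pt t)) (𝓝[<] 1) (𝓝 W)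

/-- A matrix of rational functions as a matrix-valued function on `ℂ` (with junk values at
the poles of the entries only). -/
def ratMat {M : ℕ} (Φ : Matrix (Fin M) (Fin M) (RatFunc ℂ)) (z : ℂ) : Matrix (Fin M) (Fin M) ℂ :=
  Φ.map (RatFunc.eval (RingHom.id ℂ) z)

/-- All poles of the entries (zeros of the reduced denominators) lie outside the closed disk. -/
def PolesInExterior {M : ℕ} (Φ : Matrix (Fin M) (Fin M) (RatFunc ℂ)) : Prop :=
  ∀ i j, ∀ z : ℂ, (Φ i j).denom.eval z = 0 → 1 < ‖z‖

end Isopair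

end

/-!
The isometries are modelled by the transfer function of a finite-dimensional unitary colligation.

By the Wold decomposition (`exists_wold_basis`) the pure isometry `S` is the shift on the
orthogonal sum of the spaces `Sⁿ ker S*`, which gives the unitary `U` onto the Hardy space of
`ℂ^M`, where `M = dim ker S*`. The space `ker (ST)*` is both `ker S* ⊕ S ker T*` and
`T ker S* ⊕ ker T*`; comparing the two decompositions gives a unitary block matrix `[A B; C D]`
on `ℂ^M ⊕ ℂ^N` with `T v = A v + S C v` for `v ∈ ker S*` and `u = B u + S D u` for `u ∈ ker T*`
(`exists_colligation`). Reading these relations in the model, where `S` is multiplication by `z`,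
shows that `T` becomes multiplication by `Φ(z) = A + zB(1 - zD)⁻¹C` (`act_ratMat_eq`).

This function is rational because `ker T*` is finite-dimensional. Since `D` is the restriction of
`S*` to `ker T*`, and the contraction `S*` has no eigenvalue on the unit circle
(`eq_zero_of_eq_smul_adjoint`, by purity of `S`), its poles lie outside the closed disk. It is
contractive on the disk and unitary on the circle by the energy balance of `[A B; C D]`
(`norm_sq_act_ratMat`).

Finally, evaluation at a point `z` of the disk intertwines `(S, T)` with `(z, Φ(z))` and is onto
`ℂ^M`, so that `p(S, T) = 0` forces `p(z, Φ(z)) = 0`, on the closed disk by continuity. On the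
circle this is `p(J_z, J_Φ) = 0`.
-/

namespace Isopair

open scoped InnerProductSpace

/-! ### Vector-valued Fourier analysis on the circle -/

theorem act_eq_toLpLin {M : ℕ} (A : Matrix (Fin M) (Fin M) ℂ) (v : EuclideanSpace ℂ (Fin M)) :
    act A v = Matrix.toLpLin 2 2 A v := rfl

theorem act_add {M : ℕ} (A : Matrix (Fin M) (Fin M) ℂ) (v w : EuclideanSpace ℂ (Fin M)) :
    act A (v + w) = act A v + act A w := by
  simp only [act_eq_toLpLin, map_add]

theorem act_smul {M : ℕ} (A : Matrix (Fin M) (Fin M) ℂ) (c : ℂ) (v : EuclideanSpace ℂ (Fin M)) :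
    act A (c • v) = c • act A v := by
  simp only [act_eq_toLpLin, map_smul]

theorem act_coordFun {M : ℕ} (z : ℂ) (v : EuclideanSpace ℂ (Fin M)) :
    act (coordFun M z) v = z • v := by
  ext i
  simp [act, coordFun]

theorem act_mul {M : ℕ} (A B : Matrix (Fin M) (Fin M) ℂ) (v : EuclideanSpace ℂ (Fin M)) :
    act (A * B) v = act A (act B v) := by
  simp [act, Matrix.mulVec_mulVec]

theorem continuous_act {M : ℕ} :
    Continuous fun x : Matrix (Fin M) (Fin M) ℂ × EuclideanSpace ℂ (Fin M) => act x.1 x.2 := by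
  unfold act
  fun_prop

/-- The monomial `e^{int} v` as an element of `L²_{ℂ^M}`, linear in `v`. -/
noncomputable def monomialL2 {M : ℕ} (n : ℤ) : EuclideanSpace ℂ (Fin M) →ₗ[ℂ] L2 M where
  toFun v := ContinuousMap.toLp 2 circMeas ℂ ⟨fun t => fourier n t • v, by fun_prop⟩
  map_add' v w := by
    rw [← map_add]
    congr 1
    ext t : 1
    simp
  map_smul' c v := by
    rw [RingHom.id_apply, ← map_smul]
    congr 1
    ext t : 1
    exact smul_comm _ _ _

theorem coeFn_monomialL2 {M : ℕ} (n : ℤ) (v : EuclideanSpace ℂ (Fin M)) :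
    (monomialL2 n v : Circ → EuclideanSpace ℂ (Fin M)) =ᵐ[circMeas] fun t => fourier n t • v :=
  ContinuousMap.coeFn_toLp (p := 2) (𝕜 := ℂ) circMeas _

theorem integrable_L2 {M : ℕ} (f : L2 M) : Integrable f circMeas :=
  (Lp.memLp f).integrable one_le_two

theorem inner_monomialL2 {M : ℕ} (n : ℤ) (v : EuclideanSpace ℂ (Fin M)) (f : L2 M) :
    ⟪monomialL2 n v, f⟫_ℂ = ⟪v, fourierCoeff (f : Circ → EuclideanSpace ℂ (Fin M)) n⟫_ℂ := by
  rw [L2.inner_def, fourierCoeff, ← integral_inner ((integrable_L2 f).fourier_smul _)]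
  apply integral_congr_ae
  filter_upwards [coeFn_monomialL2 n v] with t ht
  rw [ht, inner_smul_left, inner_smul_right, ← fourier_neg]

theorem fourierCoeff_monomialL2 {M : ℕ} (m n : ℤ) (v : EuclideanSpace ℂ (Fin M)) :
    fourierCoeff (monomialL2 m v : Circ → EuclideanSpace ℂ (Fin M)) n = if n = m then v else 0 := by
  have h := congr_fun (fourierCoeff_fourier (T := 2 * Real.pi) m) n
  rw [fourierCoeff_congr_ae (coeFn_monomialL2 m v)]
  unfold fourierCoeff at h ⊢
  simp only [← smul_assoc]
  rw [integral_smul_const, h]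
  by_cases hmn : n = m <;> simp [hmn]

theorem norm_monomialL2 {M : ℕ} (n : ℤ) (v : EuclideanSpace ℂ (Fin M)) :
    ‖monomialL2 n v‖ = ‖v‖ := by
  have h := inner_monomialL2 n v (monomialL2 n v)
  rw [fourierCoeff_monomialL2, if_pos rfl, inner_self_eq_norm_sq_to_K,
    inner_self_eq_norm_sq_to_K] at h
  exact (sq_eq_sq₀ (norm_nonneg _) (norm_nonneg _)).1 (by exact_mod_cast h)

theorem norm_fourierCoeff_le {M : ℕ} (f : L2 M) (n : ℤ) :
    ‖fourierCoeff (f : Circ → EuclideanSpace ℂ (Fin M)) n‖ ≤ ‖f‖ := by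
  set v := fourierCoeff (f : Circ → EuclideanSpace ℂ (Fin M)) n with hv
  rcases eq_or_ne v 0 with h0 | h0
  · simp [h0]
  have h : ‖⟪v, v⟫_ℂ‖ ≤ ‖v‖ * ‖f‖ := by
    rw [← norm_monomialL2 n v]
    conv_lhs => rw [hv, ← hv, ← inner_monomialL2 n v f]
    exact norm_inner_le_norm _ _
  rw [inner_self_eq_norm_sq_to_K, norm_pow, sq] at h
  refine le_of_mul_le_mul_left ?_ (norm_pos_iff.2 h0)
  simpa using h

/-- The Fourier coefficient of index `n` as a continuous linear map. -/
noncomputable def fourierCoeffCLM (M : ℕ) (n : ℤ) : L2 M →L[ℂ] EuclideanSpace ℂ (Fin M) :=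
  LinearMap.mkContinuous
    { toFun := fun f => fourierCoeff (f : Circ → EuclideanSpace ℂ (Fin M)) n
      map_add' := fun f g => by
        rw [fourierCoeff_congr_ae (Lp.coeFn_add f g),
          fourierCoeff.add (integrable_L2 f) (integrable_L2 g), Pi.add_apply]
      map_smul' := fun c f => by
        rw [fourierCoeff_congr_ae (Lp.coeFn_smul c f), fourierCoeff.const_smul, RingHom.id_apply] }
    1 fun f => by simpa using norm_fourierCoeff_le f n

theorem fourierCoeffCLM_apply {M : ℕ} (n : ℤ) (f : L2 M) :
    fourierCoeffCLM M n f = fourierCoeff (f : Circ → EuclideanSpace ℂ (Fin M)) n := rfl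

/-- Fourier coefficients determine a function, by completeness of the scalar Fourier basis applied
to each coordinate. -/
theorem eq_zero_of_fourierCoeff_eq_zero {M : ℕ} (f : L2 M)
    (hf : ∀ n, fourierCoeff (f : Circ → EuclideanSpace ℂ (Fin M)) n = 0) : f = 0 := by
  have key : ∀ i : Fin M, ∀ᵐ t ∂circMeas, f t i = 0 := by
    intro i
    set L : EuclideanSpace ℂ (Fin M) →L[ℂ] ℂ := EuclideanSpace.proj i
    have h0 : L.compLp f = 0 := by
      apply (fourierBasis (T := 2 * Real.pi)).repr.injective
      ext n
      rw [fourierBasis_repr, map_zero, fourierCoeff_congr_ae (L.coeFn_compLp f)]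
      change _ = (0 : ℂ)
      have h1 := L.integral_comp_comm ((integrable_L2 f).fourier_smul (-n))
      have h2 := hf n
      unfold fourierCoeff at h2 ⊢
      rw [h2, map_zero] at h1
      simp only [map_smul] at h1
      exact h1
    filter_upwards [L.coeFn_compLp f, Lp.coeFn_zero ℂ 2 circMeas] with t ht ht0
    have : L (f t) = 0 := by rw [← ht, h0, ht0]; rfl
    exact this
  rw [Lp.eq_zero_iff_ae_eq_zero]
  filter_upwards [ae_all_iff.2 key] with t ht
  ext i
  exact ht i

/-! ### The Hardy space -/

theorem mem_Hardy {M : ℕ} (f : L2 M) :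
    f ∈ Hardy M ↔ ∀ n : ℤ, n < 0 → fourierCoeff (f : Circ → EuclideanSpace ℂ (Fin M)) n = 0 :=
  Iff.rfl

theorem isClosed_Hardy (M : ℕ) : IsClosed (Hardy M : Set (L2 M)) := by
  have : (Hardy M : Set (L2 M)) = ⋂ (n : ℤ) (_ : n < 0), {f | fourierCoeffCLM M n f = 0} := by
    ext f
    simp [mem_Hardy, fourierCoeffCLM_apply]
  rw [this]
  exact isClosed_iInter fun n => isClosed_iInter fun _ =>
    isClosed_eq (fourierCoeffCLM M n).continuous continuous_const

noncomputable instance instCompleteSpaceHardy (M : ℕ) : CompleteSpace (Hardy M) :=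
  (isClosed_Hardy M).completeSpace_coe

theorem monomialL2_mem_Hardy {M : ℕ} (n : ℕ) (v : EuclideanSpace ℂ (Fin M)) :
    monomialL2 (n : ℤ) v ∈ Hardy M := by
  intro k hk
  rw [fourierCoeff_monomialL2, if_neg (by omega)]

/-- The polynomial `zⁿ v` as an element of the Hardy space. -/
noncomputable def monomialHardy {M : ℕ} (n : ℕ) (v : EuclideanSpace ℂ (Fin M)) : Hardy M :=
  ⟨monomialL2 n v, monomialL2_mem_Hardy n v⟩

/-- The standard unit vector `e_i` of `ℂ^M`. -/
noncomputable abbrev stdVec {M : ℕ} (i : Fin M) : EuclideanSpace ℂ (Fin M) :=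
  EuclideanSpace.basisFun (Fin M) ℂ i

theorem orthonormal_monomialHardy (M : ℕ) :
    Orthonormal ℂ fun k : ℕ × Fin M => monomialHardy k.1 (stdVec k.2) := by
  rw [orthonormal_iff_ite]
  rintro ⟨n, i⟩ ⟨m, j⟩
  rw [Submodule.coe_inner]
  simp only [monomialHardy]
  rw [inner_monomialL2, fourierCoeff_monomialL2]
  have := orthonormal_iff_ite.1 (EuclideanSpace.basisFun (Fin M) ℂ).orthonormal i j
  by_cases h : n = m
  · simp only [h, if_true, Prod.mk.injEq, true_and]
    exact this
  · simp [h]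

theorem orthogonal_span_monomialHardy (M : ℕ) :
    (Submodule.span ℂ (Set.range fun k : ℕ × Fin M => monomialHardy k.1 (stdVec k.2)))ᗮ = ⊥ := by
  rw [Submodule.eq_bot_iff]
  intro f hf
  rw [Submodule.mem_orthogonal] at hf
  apply Subtype.ext
  apply eq_zero_of_fourierCoeff_eq_zero
  intro n
  rcases lt_or_ge n 0 with hn | hn
  · exact f.2 n hn
  lift n to ℕ using hn
  ext i
  have := hf _ (Submodule.subset_span ⟨(n, i), rfl⟩)
  rw [Submodule.coe_inner] at this
  simp only [monomialHardy] at this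
  rw [inner_monomialL2] at this
  simpa [EuclideanSpace.inner_single_left] using this

/-- The orthonormal basis `zⁿ e_i` of the Hardy space. -/
noncomputable def hardyBasis (M : ℕ) : HilbertBasis (ℕ × Fin M) ℂ (Hardy M) :=
  HilbertBasis.mkOfOrthogonalEqBot (orthonormal_monomialHardy M) (orthogonal_span_monomialHardy M)

theorem hardyBasis_apply {M : ℕ} (k : ℕ × Fin M) :
    hardyBasis M k = monomialHardy k.1 (stdVec k.2) := by
  rw [hardyBasis, HilbertBasis.coe_mkOfOrthogonalEqBot]

/-- Evaluation of Hardy space functions at a point of the open disk as a bounded operator. -/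
theorem exists_discValue_clm (M : ℕ) {z : ℂ} (hz : ‖z‖ < 1) :
    ∃ L : Hardy M →L[ℂ] EuclideanSpace ℂ (Fin M), ∀ f, L f = discValue f z := by
  have hs : ∀ f : Hardy M, Summable fun n : ℕ =>
      z ^ n • fourierCoeffCLM M n (f : L2 M) := fun f => by
    refine Summable.of_norm_bounded
      ((summable_geometric_of_lt_one (norm_nonneg z) hz).mul_right ‖f‖) fun n => ?_
    rw [norm_smul, norm_pow]
    exact mul_le_mul_of_nonneg_left (norm_fourierCoeff_le (f : L2 M) n) (by positivity)
  refine ⟨LinearMap.mkContinuous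
    { toFun := fun f => ∑' n : ℕ, z ^ n • fourierCoeffCLM M n (f : L2 M)
      map_add' := fun f g => ?_
      map_smul' := fun c f => ?_ } (1 - ‖z‖)⁻¹ fun f => ?_, fun f => rfl⟩
  · simp only [Submodule.coe_add, map_add, smul_add]
    exact (hs f).tsum_add (hs g)
  · simp only [Submodule.coe_smul, map_smul, smul_comm _ c, RingHom.id_apply]
    exact (hs f).tsum_const_smul c
  · refine tsum_of_norm_bounded
      ((hasSum_geometric_of_lt_one (norm_nonneg z) hz).mul_right ‖f‖) fun n => ?_
    rw [norm_smul, norm_pow]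
    exact mul_le_mul_of_nonneg_left (norm_fourierCoeff_le (f : L2 M) n) (by positivity)

theorem discValue_monomialHardy {M : ℕ} (n : ℕ) (v : EuclideanSpace ℂ (Fin M)) (z : ℂ) :
    discValue (monomialHardy n v) z = z ^ n • v := by
  unfold discValue monomialHardy
  rw [tsum_eq_single n]
  · simp [fourierCoeff_monomialL2]
  · intro m hm
    simp [fourierCoeff_monomialL2, hm]

/-! ### Multiplication by isometric matrix functions -/

theorem memLp_act {M : ℕ} {F : Circ → Matrix (Fin M) (Fin M) ℂ} (hF : Continuous F)
    (hiso : ∀ t v, ‖act (F t) v‖ = ‖v‖) (f : L2 M) :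
    MemLp (fun t => act (F t) (f t)) 2 circMeas := by
  have hF' : AEStronglyMeasurable (β := Fin M → Fin M → ℂ) F circMeas :=
    Continuous.aestronglyMeasurable (β := Fin M → Fin M → ℂ) hF
  have h := (continuous_act (M := M)).comp_aestronglyMeasurable
    (hF'.prodMk (Lp.aestronglyMeasurable f))
  exact MemLp.congr_norm (Lp.memLp f) h (ae_of_all _ fun t => (hiso t (f t)).symm)

/-- Multiplication by a continuous function on the circle with isometric matrix values. -/
noncomputable def mulL2 {M : ℕ} (F : Circ → Matrix (Fin M) (Fin M) ℂ) (hF : Continuous F)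
    (hiso : ∀ t v, ‖act (F t) v‖ = ‖v‖) : L2 M →ₗᵢ[ℂ] L2 M :=
  { toFun := fun f => (memLp_act hF hiso f).toLp
    map_add' := fun f g => by
      rw [← MemLp.toLp_add, MemLp.toLp_eq_toLp_iff]
      filter_upwards [Lp.coeFn_add f g] with t ht
      rw [ht, Pi.add_apply, Pi.add_apply, act_add]
    map_smul' := fun c f => by
      rw [RingHom.id_apply, ← MemLp.toLp_const_smul, MemLp.toLp_eq_toLp_iff]
      filter_upwards [Lp.coeFn_smul c f] with t ht
      rw [ht, Pi.smul_apply, Pi.smul_apply, act_smul]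
    norm_map' := fun f => by
      change ‖(memLp_act hF hiso f).toLp‖ = ‖f‖
      rw [Lp.norm_def, Lp.norm_def, eLpNorm_congr_ae (memLp_act hF hiso f).coeFn_toLp]
      congr 1
      exact eLpNorm_congr_norm_ae (ae_of_all _ fun t => hiso t (f t)) }

theorem coeFn_mulL2 {M : ℕ} (F : Circ → Matrix (Fin M) (Fin M) ℂ) (hF : Continuous F)
    (hiso : ∀ t v, ‖act (F t) v‖ = ‖v‖) (f : L2 M) :
    mulL2 F hF hiso f =ᵐ[circMeas] fun t => act (F t) (f t) :=
  MemLp.coeFn_toLp (memLp_act hF hiso f)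

theorem mem_unitaryGroup_of_norm_act {M : ℕ} {A : Matrix (Fin M) (Fin M) ℂ}
    (hA : ∀ v, ‖act A v‖ = ‖v‖) : A ∈ Matrix.unitaryGroup (Fin M) ℂ := by
  rw [Matrix.mem_unitaryGroup_iff']
  let L : EuclideanSpace ℂ (Fin M) →ₗᵢ[ℂ] EuclideanSpace ℂ (Fin M) :=
    ⟨Matrix.toLpLin 2 2 A, hA⟩
  have h := fun v w => L.inner_map_map v w
  ext i j
  have h1 := h (stdVec i) (stdVec j)
  have h2 := orthonormal_iff_ite.1 (EuclideanSpace.basisFun (Fin M) ℂ).orthonormal i j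
  rw [Matrix.one_apply, ← h2, ← h1, PiLp.inner_apply]
  have hL : ∀ k x, L (stdVec k) x = A x k := fun k x => by
    change act A (stdVec k) x = A x k
    simp [act]
  simp only [hL]
  simp [Matrix.mul_apply, mul_comm]

/-- The multiplication operator is onto: its inverse is multiplication by the adjoint matrices. -/
theorem mulL2_mem_unitary {M : ℕ} (F : Circ → Matrix (Fin M) (Fin M) ℂ) (hF : Continuous F)
    (hiso : ∀ t v, ‖act (F t) v‖ = ‖v‖) :
    (mulL2 F hF hiso).toContinuousLinearMap ∈ unitary (L2 M →L[ℂ] L2 M) := by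
  set J := (mulL2 F hF hiso).toContinuousLinearMap with hJ
  have hr : ∀ t, F t * star (F t) = 1 := fun t =>
    Matrix.mem_unitaryGroup_iff.1 (mem_unitaryGroup_of_norm_act (hiso t))
  have one_act : ∀ v, act (1 : Matrix (Fin M) (Fin M) ℂ) v = v := fun v => by simp [act]
  have hiso' : ∀ t v, ‖act (star (F t)) v‖ = ‖v‖ := fun t v => by
    rw [← hiso t, ← act_mul, hr, one_act]
  set K := (mulL2 (fun t => star (F t)) hF.star hiso').toContinuousLinearMap with hK
  have h1 : star J * J = 1 :=
    (ContinuousLinearMap.norm_map_iff_adjoint_comp_self J).1 (mulL2 F hF hiso).norm_map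
  have h2 : J * K = 1 := by
    ext1 f
    apply Lp.ext
    filter_upwards [coeFn_mulL2 F hF hiso (K f), coeFn_mulL2 _ hF.star hiso' f] with t ht ht'
    change mulL2 F hF hiso (K f) t = f t
    rw [ht]
    change act (F t) (mulL2 _ hF.star hiso' f t) = f t
    rw [ht', ← act_mul, hr, one_act]
  have h3 : star J = K := left_inv_eq_right_inv h1 h2
  rw [Unitary.mem_iff]
  exact ⟨h1, h3 ▸ h2⟩

/-! ### The Wold decomposition of a pure isometry -/

section Wold

variable {H : Type*} [NormedAddCommGroup H] [InnerProductSpace ℂ H] [CompleteSpace H]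

theorem adjoint_apply_of_isometry {V : H →L[ℂ] H} (hV : Isometry V) (x : H) :
    (ContinuousLinearMap.adjoint V) (V x) = x := by
  have h := (ContinuousLinearMap.norm_map_iff_adjoint_comp_self V).1
    ((AddMonoidHomClass.isometry_iff_norm V).1 hV)
  exact DFunLike.congr_fun h x

/-- Coordinates on the finite-dimensional wandering subspace `ker V*`. -/
theorem exists_isometry_onto_ker_adjoint {V : H →L[ℂ] H} {M : ℕ} (hM : mult V = M) :
    ∃ ι : EuclideanSpace ℂ (Fin M) →ₗᵢ[ℂ] H,
      ∀ x, ContinuousLinearMap.adjoint V x = 0 ↔ ∃ v, ι v = x := by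
  unfold mult at hM
  set K := (ContinuousLinearMap.adjoint V).ker with hK
  have : Module.Finite ℂ K := Module.finite_of_rank_eq_nat hM
  have hfr : Module.finrank ℂ K = M := Module.finrank_eq_of_rank_eq hM
  let e := ((stdOrthonormalBasis ℂ K).reindex (finCongr hfr)).repr.symm
  refine ⟨K.subtypeₗᵢ.comp e.toLinearIsometry, fun x => ⟨fun hx => ?_, ?_⟩⟩
  · exact ⟨e.symm ⟨x, hx⟩, by simp⟩
  · rintro ⟨v, rfl⟩
    exact (e v).2

variable {M N : ℕ} {S T : H →L[ℂ] H} {ι : EuclideanSpace ℂ (Fin M) →ₗᵢ[ℂ] H}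
  {κ : EuclideanSpace ℂ (Fin N) →ₗᵢ[ℂ] H}

theorem inner_pow_wandering (hS : Isometry S)
    (hι : ∀ v, ContinuousLinearMap.adjoint S (ι v) = 0) (n m : ℕ)
    (v w : EuclideanSpace ℂ (Fin M)) :
    ⟪(S ^ n) (ι v), (S ^ m) (ι w)⟫_ℂ = if n = m then ⟪v, w⟫_ℂ else 0 := by
  induction n generalizing m with
  | zero =>
    cases m with
    | zero => simp
    | succ m => simp [pow_succ', ← ContinuousLinearMap.adjoint_inner_left, hι]
  | succ n ih =>
    cases m with
    | zero => simp [pow_succ', ← ContinuousLinearMap.adjoint_inner_right, hι]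
    | succ m =>
      simp only [pow_succ', mul_apply_eq_comp,
        ← ContinuousLinearMap.adjoint_inner_right S, adjoint_apply_of_isometry hS, ih,
        Nat.succ_inj]

/-- A vector `y` orthogonal to the wandering subspace lies in the range of the isometry. -/
theorem apply_adjoint_eq_self (hι : ∀ x, ContinuousLinearMap.adjoint S x = 0 ↔ ∃ v, ι v = x)
    (hS : Isometry S) {y : H} (hy : ∀ v, ⟪ι v, y⟫_ℂ = 0) :
    S (ContinuousLinearMap.adjoint S y) = y := by
  set w := y - S (ContinuousLinearMap.adjoint S y) with hw
  have h0 : ContinuousLinearMap.adjoint S w = 0 := by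
    rw [hw, map_sub, adjoint_apply_of_isometry hS, sub_self]
  obtain ⟨v, hv⟩ := (hι w).1 h0
  have h1 : ⟪w, y⟫_ℂ = 0 := hv ▸ hy v
  have h2 : ⟪w, S (ContinuousLinearMap.adjoint S y)⟫_ℂ = 0 := by
    rw [← ContinuousLinearMap.adjoint_inner_left, h0, inner_zero_left]
  have h3 : ⟪w, w⟫_ℂ = 0 := by
    conv_lhs => rw [hw, inner_sub_right, ← hw, h1, h2, sub_zero]
  exact (sub_eq_zero.1 (inner_self_eq_zero.1 h3)).symm

/-- The orthogonal complement of the translates `Sⁿ ker S*` reduces `S` to a unitary, so it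
vanishes when `S` is pure. -/
theorem orthogonal_span_wandering (hS : IsPureIsometry S)
    (hι : ∀ x, ContinuousLinearMap.adjoint S x = 0 ↔ ∃ v, ι v = x) :
    (Submodule.span ℂ (Set.range fun k : ℕ × Fin M => (S ^ k.1) (ι (stdVec k.2))))ᗮ = ⊥ := by
  set K := (Submodule.span ℂ (Set.range fun k : ℕ × Fin M => (S ^ k.1) (ι (stdVec k.2))))ᗮ with hK
  have hker : ∀ v, ContinuousLinearMap.adjoint S (ι v) = 0 := fun v => (hι _).2 ⟨v, rfl⟩
  have hmem : ∀ y, y ∈ K ↔ ∀ n v, ⟪(S ^ n) (ι v), y⟫_ℂ = 0 := by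
    intro y
    rw [hK, Submodule.mem_orthogonal]
    constructor
    · intro h n v
      rw [← (EuclideanSpace.basisFun (Fin M) ℂ).sum_repr v]
      simp only [map_sum, map_smul, sum_inner, inner_smul_left]
      refine Finset.sum_eq_zero fun i _ => ?_
      rw [h _ (Submodule.subset_span ⟨(n, i), rfl⟩), mul_zero]
    · intro h x hx
      induction hx using Submodule.span_induction with
      | mem x hx => obtain ⟨k, rfl⟩ := hx; exact h _ _
      | zero => simp
      | add x z _ _ hx hz => rw [inner_add_left, hx, hz, add_zero]
      | smul c x _ hx => rw [inner_smul_left, hx, mul_zero]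
  refine hS.pure K (Submodule.isClosed_orthogonal _) ?_ ?_ ?_
  · intro y hy
    rw [hmem] at hy ⊢
    intro n v
    rw [← ContinuousLinearMap.adjoint_inner_left]
    cases n with
    | zero => simp [hker]
    | succ n =>
      rw [pow_succ', mul_apply_eq_comp, adjoint_apply_of_isometry hS.isometry, hy]
  · intro y hy
    rw [hmem] at hy ⊢
    intro n v
    rw [ContinuousLinearMap.adjoint_inner_right, ← mul_apply_eq_comp, ← pow_succ', hy]
  · intro y hy
    rw [hmem] at hy
    refine ⟨ContinuousLinearMap.adjoint S y, ?_,
      apply_adjoint_eq_self hι hS.isometry fun v => hy 0 v⟩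
    rw [hmem]
    intro n v
    rw [ContinuousLinearMap.adjoint_inner_right, ← mul_apply_eq_comp, ← pow_succ', hy]

/-- The orthonormal basis `Sⁿ ι(e_i)` given by the Wold decomposition of a pure isometry. -/
theorem exists_wold_basis (hS : IsPureIsometry S)
    (hι : ∀ x, ContinuousLinearMap.adjoint S x = 0 ↔ ∃ v, ι v = x) :
    ∃ b : HilbertBasis (ℕ × Fin M) ℂ H, ∀ k, b k = (S ^ k.1) (ι (stdVec k.2)) := by
  have hker : ∀ v, ContinuousLinearMap.adjoint S (ι v) = 0 := fun v => (hι _).2 ⟨v, rfl⟩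
  have ho : Orthonormal ℂ fun k : ℕ × Fin M => (S ^ k.1) (ι (stdVec k.2)) := by
    rw [orthonormal_iff_ite]
    rintro ⟨n, i⟩ ⟨m, j⟩
    rw [inner_pow_wandering hS.isometry hker]
    have := orthonormal_iff_ite.1 (EuclideanSpace.basisFun (Fin M) ℂ).orthonormal i j
    by_cases h : n = m
    · simp only [h, if_true, Prod.mk.injEq, true_and]
      exact this
    · simp [h]
  exact ⟨HilbertBasis.mkOfOrthogonalEqBot ho (orthogonal_span_wandering hS hι),
    fun k => by rw [HilbertBasis.coe_mkOfOrthogonalEqBot]⟩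

/-- The adjoint of a pure isometry has no eigenvalue outside the open unit disk: an eigenvector of
a unimodular eigenvalue would span a reducing subspace. -/
theorem eq_zero_of_eq_smul_adjoint (hS : IsPureIsometry S) {z : ℂ} (hz : ‖z‖ ≤ 1) {x : H}
    (hx : x = z • ContinuousLinearMap.adjoint S x) : x = 0 := by
  have hSn : ∀ y, ‖S y‖ = ‖y‖ := (AddMonoidHomClass.isometry_iff_norm S).1 hS.isometry
  have hle : ‖ContinuousLinearMap.adjoint S x‖ ≤ ‖x‖ := by
    have h1 : ‖ContinuousLinearMap.adjoint S‖ ≤ 1 := by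
      rw [LinearIsometryEquiv.norm_map]
      exact ContinuousLinearMap.opNorm_le_bound _ zero_le_one fun y => by rw [hSn, one_mul]
    simpa using (ContinuousLinearMap.adjoint S).le_of_opNorm_le h1 x
  by_contra hx0
  have hn : ‖x‖ = ‖z‖ * ‖ContinuousLinearMap.adjoint S x‖ := by
    conv_lhs => rw [hx, norm_smul]
  have hpos : 0 < ‖x‖ := norm_pos_iff.2 hx0
  have hz1 : ‖z‖ = 1 := le_antisymm hz (by nlinarith [norm_nonneg z])
  have hz0 : z ≠ 0 := norm_ne_zero_iff.1 (by rw [hz1]; exact one_ne_zero)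
  have hadj : ContinuousLinearMap.adjoint S x = z⁻¹ • x := by
    conv_rhs => rw [hx]
    rw [smul_smul, inv_mul_cancel₀ hz0, one_smul]
  -- equality in the Cauchy-Schwarz inequality forces `S S* x = x`
  have hSS : S (ContinuousLinearMap.adjoint S x) = x := by
    have hre : RCLike.re ⟪S (ContinuousLinearMap.adjoint S x), x⟫_ℂ = ‖x‖ ^ 2 := by
      rw [← ContinuousLinearMap.adjoint_inner_right, inner_self_eq_norm_sq, hadj, norm_smul,
        norm_inv, hz1, inv_one, one_mul]
    have h0 : ‖S (ContinuousLinearMap.adjoint S x) - x‖ ^ 2 = 0 := by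
      rw [norm_sub_sq (𝕜 := ℂ), hre, hSn, hadj, norm_smul, norm_inv, hz1, inv_one, one_mul]
      ring
    exact sub_eq_zero.1 (norm_eq_zero.1 (pow_eq_zero_iff two_ne_zero |>.1 h0))
  have hSx : S x = z • x := by
    conv_lhs => rw [hx, map_smul, hSS]
  have hbot := hS.pure (Submodule.span ℂ {x}) (Submodule.closed_of_finiteDimensional _) ?_ ?_ ?_
  · exact hx0 (by simpa using hbot)
  · intro y hy
    obtain ⟨c, rfl⟩ := Submodule.mem_span_singleton.1 hy
    rw [map_smul, hSx]
    exact Submodule.smul_mem _ _ (Submodule.smul_mem _ _ (Submodule.mem_span_singleton_self x))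
  · intro y hy
    obtain ⟨c, rfl⟩ := Submodule.mem_span_singleton.1 hy
    rw [map_smul, hadj]
    exact Submodule.smul_mem _ _ (Submodule.smul_mem _ _ (Submodule.mem_span_singleton_self x))
  · intro y hy
    obtain ⟨c, rfl⟩ := Submodule.mem_span_singleton.1 hy
    refine ⟨(c * z⁻¹) • x,
      Submodule.smul_mem _ _ (Submodule.mem_span_singleton_self x), ?_⟩
    rw [map_smul, hSx, smul_smul, mul_assoc, inv_mul_cancel₀ hz0, mul_one]

/-! ### The unitary colligation of a commuting pair of isometries -/

/-- The subspace `ker (ST)*` decomposes both as `ker S* ⊕ S ker T*` and as `T ker S* ⊕ ker T*`. In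
the coordinates `ι` of `ker S*` and `κ` of `ker T*`, passing from the second decomposition to the
first is the unitary block operator `[A B; C D]` on `ℂ^M ⊕ ℂ^N`. -/
theorem exists_colligation (hS : Isometry S) (hT : Isometry T) (hST : Commute S T)
    (hι : ∀ x, ContinuousLinearMap.adjoint S x = 0 ↔ ∃ v, ι v = x)
    (hκ : ∀ x, ContinuousLinearMap.adjoint T x = 0 ↔ ∃ u, κ u = x) :
    ∃ (A : EuclideanSpace ℂ (Fin M) →ₗ[ℂ] EuclideanSpace ℂ (Fin M))
      (B : EuclideanSpace ℂ (Fin N) →ₗ[ℂ] EuclideanSpace ℂ (Fin M))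
      (C : EuclideanSpace ℂ (Fin M) →ₗ[ℂ] EuclideanSpace ℂ (Fin N))
      (D : EuclideanSpace ℂ (Fin N) →ₗ[ℂ] EuclideanSpace ℂ (Fin N)),
      (∀ v, T (ι v) = ι (A v) + S (κ (C v))) ∧ (∀ u, κ u = ι (B u) + S (κ (D u))) ∧
      ∀ v u, ‖A v + B u‖ ^ 2 + ‖C v + D u‖ ^ 2 = ‖v‖ ^ 2 + ‖u‖ ^ 2 := by
  have hιker : ∀ v, ContinuousLinearMap.adjoint S (ι v) = 0 := fun v => (hι _).2 ⟨v, rfl⟩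
  have hκker : ∀ v, ContinuousLinearMap.adjoint T (κ v) = 0 := fun v => (hκ _).2 ⟨v, rfl⟩
  have hSn : ∀ y, ‖S y‖ = ‖y‖ := (AddMonoidHomClass.isometry_iff_norm S).1 hS
  have hTn : ∀ y, ‖T y‖ = ‖y‖ := (AddMonoidHomClass.isometry_iff_norm T).1 hT
  set Sa := ContinuousLinearMap.adjoint S with hSa
  set Ta := ContinuousLinearMap.adjoint T with hTa
  have hcomm : ∀ x, Ta (Sa x) = Sa (Ta x) := by
    have h : Sa * Ta = Ta * Sa := by
      have := congrArg star hST.eq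
      rw [star_mul, star_mul] at this
      exact this.symm
    exact fun x => (DFunLike.congr_fun h x).symm
  set P := ContinuousLinearMap.adjoint ι.toContinuousLinearMap with hP
  set Q := ContinuousLinearMap.adjoint κ.toContinuousLinearMap with hQ
  have hPι : ∀ v, P (ι v) = v := fun v => by
    have h := (ContinuousLinearMap.norm_map_iff_adjoint_comp_self ι.toContinuousLinearMap).1
      ι.norm_map
    exact DFunLike.congr_fun h v
  have hQκ : ∀ v, Q (κ v) = v := fun v => by
    have h := (ContinuousLinearMap.norm_map_iff_adjoint_comp_self κ.toContinuousLinearMap).1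
      κ.norm_map
    exact DFunLike.congr_fun h v
  have hPS : ∀ x, P (S x) = 0 := fun x => by
    refine ext_inner_left ℂ fun v => ?_
    rw [hP, ContinuousLinearMap.adjoint_inner_right, inner_zero_right]
    change ⟪ι v, S x⟫_ℂ = 0
    rw [← ContinuousLinearMap.adjoint_inner_left, ← hSa, hιker, inner_zero_left]
  have hdec : ∀ x, Ta (Sa x) = 0 → x = ι (P x) + S (κ (Q (Sa x))) := by
    intro x hx
    obtain ⟨u, hu⟩ := (hκ _).1 hx
    have h0 : Sa (x - S (Sa x)) = 0 := by
      rw [map_sub, hSa, adjoint_apply_of_isometry hS, sub_self]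
    obtain ⟨v, hv⟩ := (hι _).1 h0
    have hPx : P x = v := by
      rw [← hPι v, hv, map_sub, hPS, sub_zero]
    rw [hPx, hv, ← hu, hQκ, hu, sub_add_cancel]
  have h1 : ∀ v, T (ι v) = ι (P (T (ι v))) + S (κ (Q (Sa (T (ι v))))) := fun v => by
    refine hdec _ ?_
    rw [hcomm, hTa, adjoint_apply_of_isometry hT, hιker]
  have h2 : ∀ u, κ u = ι (P (κ u)) + S (κ (Q (Sa (κ u)))) := fun u => by
    refine hdec _ ?_
    rw [hcomm, hκker, map_zero]
  refine ⟨(P ∘L T ∘L ι.toContinuousLinearMap).toLinearMap,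
    (P ∘L κ.toContinuousLinearMap).toLinearMap,
    (Q ∘L Sa ∘L T ∘L ι.toContinuousLinearMap).toLinearMap,
    (Q ∘L Sa ∘L κ.toContinuousLinearMap).toLinearMap, h1, h2, fun v u => ?_⟩
  change ‖P (T (ι v)) + P (κ u)‖ ^ 2 + ‖Q (Sa (T (ι v))) + Q (Sa (κ u))‖ ^ 2 = _
  have hsum : T (ι v) + κ u = ι (P (T (ι v)) + P (κ u)) +
      S (κ (Q (Sa (T (ι v))) + Q (Sa (κ u)))) := by
    conv_lhs => rw [h1 v, h2 u]
    simp only [map_add]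
    abel
  have e1 := norm_add_sq_eq_norm_sq_add_norm_sq_of_inner_eq_zero (𝕜 := ℂ) (T (ι v)) (κ u) (by
    rw [← ContinuousLinearMap.adjoint_inner_right, ← hTa, hκker, inner_zero_right])
  have e2 := norm_add_sq_eq_norm_sq_add_norm_sq_of_inner_eq_zero (𝕜 := ℂ)
    (ι (P (T (ι v)) + P (κ u))) (S (κ (Q (Sa (T (ι v))) + Q (Sa (κ u))))) (by
    rw [← ContinuousLinearMap.adjoint_inner_left, ← hSa, hιker, inner_zero_left])
  rw [← hsum, e1, hSn, hTn, ι.norm_map, ι.norm_map, κ.norm_map, κ.norm_map] at e2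
  linarith

end Wold

/-! ### Rational transfer functions -/

open Polynomial in
/-- The transfer function `A + zB(1 - zD)⁻¹C` is a matrix of rational functions, and its poles are
among the points `z` with `z⁻¹` an eigenvalue of `D`. -/
theorem exists_transferFunction {M N : ℕ} (A : Matrix (Fin M) (Fin M) ℂ)
    (B : Matrix (Fin M) (Fin N) ℂ) (C : Matrix (Fin N) (Fin M) ℂ) (D : Matrix (Fin N) (Fin N) ℂ)
    (hD : ∀ z : ℂ, ‖z‖ ≤ 1 → ∀ u : Fin N → ℂ, u = z • D.mulVec u → u = 0) :
    ∃ Φ : Matrix (Fin M) (Fin M) (RatFunc ℂ), PolesInExterior Φ ∧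
      ∀ z : ℂ, ‖z‖ ≤ 1 → ∀ (v : Fin M → ℂ) (u : Fin N → ℂ), u = C.mulVec v + z • D.mulVec u →
        (ratMat Φ z).mulVec v = A.mulVec v + z • B.mulVec u := by
  let R : Matrix (Fin N) (Fin N) ℂ[X] := 1 - (X : ℂ[X]) • D.map Polynomial.C
  let d : ℂ[X] := R.det
  let P : Matrix (Fin M) (Fin M) ℂ[X] := d • A.map Polynomial.C +
    (X : ℂ[X]) • (B.map Polynomial.C * R.adjugate * C.map Polynomial.C)
  have hR : ∀ z : ℂ, (evalRingHom z).mapMatrix R = 1 - z • D := fun z => by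
    ext i j
    simp [R, Matrix.one_apply, apply_ite (eval z)]
    exact mul_comm _ _
  have hd : ∀ z : ℂ, d.eval z = (1 - z • D).det := fun z => by
    rw [← hR, ← RingHom.map_det]
    rfl
  have hmap : ∀ (m n : ℕ) (E : Matrix (Fin m) (Fin n) ℂ) (z : ℂ),
      (E.map Polynomial.C).map (evalRingHom z) = E := fun m n E z => by
    ext i j
    simp
  have hP : ∀ z : ℂ, P.map (evalRingHom z) =
      d.eval z • A + z • (B * (1 - z • D).adjugate * C) := fun z => by
    have h1 : (B.map Polynomial.C * R.adjugate * C.map Polynomial.C).map (evalRingHom z) =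
        B * (1 - z • D).adjugate * C := by
      rw [Matrix.map_mul, Matrix.map_mul, hmap, hmap, ← hR, ← RingHom.map_adjugate]
      rfl
    rw [← h1]
    ext i j
    simp [P]
  have hd0 : ∀ z : ℂ, ‖z‖ ≤ 1 → d.eval z ≠ 0 := fun z hz h0 => by
    rw [hd] at h0
    obtain ⟨u, hu, hu0⟩ := Matrix.exists_mulVec_eq_zero_iff.2 h0
    refine hu (hD z hz u ?_)
    rw [Matrix.sub_mulVec, Matrix.one_mulVec, Matrix.smul_mulVec, sub_eq_zero] at hu0
    exact hu0
  have hdne : d ≠ 0 := fun h => hd0 0 (by simp) (by rw [h, eval_zero])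
  let Φ : Matrix (Fin M) (Fin M) (RatFunc ℂ) := fun i j =>
    algebraMap ℂ[X] (RatFunc ℂ) (P i j) / algebraMap ℂ[X] (RatFunc ℂ) d
  have hpoles : PolesInExterior Φ := fun i j z hz => by
    by_contra hz1
    obtain ⟨q, hq⟩ := RatFunc.denom_div_dvd (P i j) d
    refine hd0 z (not_lt.1 hz1) ?_
    rw [hq, eval_mul]
    exact mul_eq_zero_of_left hz _
  refine ⟨Φ, hpoles, fun z hz v u hu => ?_⟩
  have hΦ : d.eval z • ratMat Φ z = P.map (evalRingHom z) := by
    ext i j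
    have hden : ∀ q : ℂ[X], (algebraMap ℂ[X] (RatFunc ℂ) q).denom.eval₂ (RingHom.id ℂ) z ≠ 0 :=
      fun q => by simp
    have h1 : Φ i j * algebraMap ℂ[X] (RatFunc ℂ) d = algebraMap ℂ[X] (RatFunc ℂ) (P i j) :=
      div_mul_cancel₀ _ (RatFunc.algebraMap_ne_zero hdne)
    have h2 : (Φ i j).denom.eval₂ (RingHom.id ℂ) z ≠ 0 := fun h0 =>
      absurd (hpoles i j z h0) (not_lt.2 hz)
    have h3 := RatFunc.eval_mul (f := RingHom.id ℂ) (a := z) h2 (hden d)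
    rw [h1, RatFunc.eval_algebraMap, RatFunc.eval_algebraMap] at h3
    simp only [Algebra.algebraMap_self, RingHom.id_apply, eval₂_id] at h3
    simp only [Matrix.smul_apply, ratMat, Matrix.map_apply, smul_eq_mul, coe_evalRingHom]
    rw [h3, mul_comm]
  have hCv : C.mulVec v = (1 - z • D).mulVec u := by
    rw [Matrix.sub_mulVec, Matrix.one_mulVec, Matrix.smul_mulVec, eq_sub_iff_add_eq]
    exact hu.symm
  have hadj : (1 - z • D).adjugate.mulVec ((1 - z • D).mulVec u) = d.eval z • u := by
    rw [Matrix.mulVec_mulVec, Matrix.adjugate_mul, ← hd, Matrix.smul_mulVec, Matrix.one_mulVec]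
  have key : d.eval z • (ratMat Φ z).mulVec v = d.eval z • (A.mulVec v + z • B.mulVec u) := by
    rw [← Matrix.smul_mulVec, hΦ, hP, Matrix.add_mulVec, Matrix.smul_mulVec, Matrix.smul_mulVec,
      ← Matrix.mulVec_mulVec, ← Matrix.mulVec_mulVec, hCv, hadj, Matrix.mulVec_smul, smul_add,
      smul_comm z]
  exact smul_right_injective _ (hd0 z hz) key

theorem differentiableAt_ratMat {M : ℕ} {Φ : Matrix (Fin M) (Fin M) (RatFunc ℂ)}
    (hΦ : PolesInExterior Φ) {z : ℂ} (hz : ‖z‖ ≤ 1) (i j : Fin M) :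
    DifferentiableAt ℂ (fun z => ratMat Φ z i j) z := by
  have h : (Φ i j).denom.eval z ≠ 0 := fun h0 => absurd (hΦ i j z h0) (not_lt.2 hz)
  simp only [ratMat, Matrix.map_apply, RatFunc.eval, Polynomial.eval₂_id]
  exact (Polynomial.differentiable _ z).div (Polynomial.differentiable _ z) h

theorem continuousAt_ratMat {M : ℕ} {Φ : Matrix (Fin M) (Fin M) (RatFunc ℂ)}
    (hΦ : PolesInExterior Φ) {z : ℂ} (hz : ‖z‖ ≤ 1) : ContinuousAt (ratMat Φ) z :=
  continuousAt_pi.2 fun i => continuousAt_pi.2 fun j =>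
    (differentiableAt_ratMat hΦ hz i j).continuousAt

/-- The transfer function in terms of the state `u` at the point `z` with input `v`. -/
theorem exists_transferFunction_linearMap {M N : ℕ}
    (A : EuclideanSpace ℂ (Fin M) →ₗ[ℂ] EuclideanSpace ℂ (Fin M))
    (B : EuclideanSpace ℂ (Fin N) →ₗ[ℂ] EuclideanSpace ℂ (Fin M))
    (C : EuclideanSpace ℂ (Fin M) →ₗ[ℂ] EuclideanSpace ℂ (Fin N))
    (D : EuclideanSpace ℂ (Fin N) →ₗ[ℂ] EuclideanSpace ℂ (Fin N))
    (hD : ∀ z : ℂ, ‖z‖ ≤ 1 → ∀ u, u = z • D u → u = 0) :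
    ∃ Φ : Matrix (Fin M) (Fin M) (RatFunc ℂ), PolesInExterior Φ ∧
      ∀ z : ℂ, ‖z‖ ≤ 1 → ∀ v u, u = C v + z • D u → act (ratMat Φ z) v = A v + z • B u := by
  have hmul : ∀ {m n : ℕ} (L : EuclideanSpace ℂ (Fin m) →ₗ[ℂ] EuclideanSpace ℂ (Fin n)) v,
      ((Matrix.toLpLin 2 2).symm L).mulVec (WithLp.ofLp v) = WithLp.ofLp (L v) := by
    intro m n L v
    conv_rhs => rw [← (Matrix.toLpLin 2 2).apply_symm_apply L]
    rfl
  obtain ⟨Φ, hΦ, h⟩ := exists_transferFunction ((Matrix.toLpLin 2 2).symm A)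
    ((Matrix.toLpLin 2 2).symm B) ((Matrix.toLpLin 2 2).symm C) ((Matrix.toLpLin 2 2).symm D)
    (fun z hz u hu => by
      have := hD z hz (WithLp.toLp 2 u) (by
        apply WithLp.ofLp_injective 2
        rw [WithLp.ofLp_smul, ← hmul]
        exact hu)
      exact congrArg WithLp.ofLp this)
  refine ⟨Φ, hΦ, fun z hz v u hu => ?_⟩
  apply WithLp.ofLp_injective 2
  rw [WithLp.ofLp_add, WithLp.ofLp_smul, ← hmul, ← hmul]
  refine h z hz _ _ ?_
  rw [hmul, hmul, ← WithLp.ofLp_smul, ← WithLp.ofLp_add, ← hu]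

/-- Solvability of the state equation. -/
theorem exists_state {N : ℕ} {D : EuclideanSpace ℂ (Fin N) →ₗ[ℂ] EuclideanSpace ℂ (Fin N)} {z : ℂ}
    (hD : ∀ u, u = z • D u → u = 0) (w : EuclideanSpace ℂ (Fin N)) : ∃ u, u = w + z • D u := by
  have hinj : Function.Injective (LinearMap.id - z • D : _ →ₗ[ℂ] EuclideanSpace ℂ (Fin N)) := by
    rw [injective_iff_map_eq_zero]
    intro u hu
    exact hD u (sub_eq_zero.1 hu)
  obtain ⟨u, hu⟩ := LinearMap.injective_iff_surjective.1 hinj w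
  exact ⟨u, by rw [← hu]; simp⟩

/-- The transfer function of an isometric colligation is isometric on the circle and contractive
on the disk, by the energy balance of `[A B; C D]` at `(v, zu)`. -/
theorem norm_sq_act_ratMat {M N : ℕ} {Φ : Matrix (Fin M) (Fin M) (RatFunc ℂ)}
    {A : EuclideanSpace ℂ (Fin M) →ₗ[ℂ] EuclideanSpace ℂ (Fin M)}
    {B : EuclideanSpace ℂ (Fin N) →ₗ[ℂ] EuclideanSpace ℂ (Fin M)}
    {C : EuclideanSpace ℂ (Fin M) →ₗ[ℂ] EuclideanSpace ℂ (Fin N)}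
    {D : EuclideanSpace ℂ (Fin N) →ₗ[ℂ] EuclideanSpace ℂ (Fin N)} {z : ℂ}
    (hD : ∀ u, u = z • D u → u = 0)
    (hiso : ∀ v u, ‖A v + B u‖ ^ 2 + ‖C v + D u‖ ^ 2 = ‖v‖ ^ 2 + ‖u‖ ^ 2)
    (hΦ : ∀ v u, u = C v + z • D u → act (ratMat Φ z) v = A v + z • B u)
    (v : EuclideanSpace ℂ (Fin M)) :
    ∃ c : ℝ, 0 ≤ c ∧ ‖act (ratMat Φ z) v‖ ^ 2 = ‖v‖ ^ 2 + (‖z‖ ^ 2 - 1) * c := by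
  obtain ⟨u, hu⟩ := exists_state hD (C v)
  refine ⟨‖u‖ ^ 2, by positivity, ?_⟩
  have h := hiso v (z • u)
  rw [map_smul, map_smul, ← hu, norm_smul, mul_pow] at h
  rw [hΦ v u hu]
  linarith

/-- A solution `k` of `k = B + z k D` equals `B(1 - zD)⁻¹`, so it determines the value of the
transfer function at `z`. -/
theorem act_ratMat_eq {M N : ℕ} {Φ : Matrix (Fin M) (Fin M) (RatFunc ℂ)}
    {A : EuclideanSpace ℂ (Fin M) →ₗ[ℂ] EuclideanSpace ℂ (Fin M)}
    {B : EuclideanSpace ℂ (Fin N) →ₗ[ℂ] EuclideanSpace ℂ (Fin M)}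
    {C : EuclideanSpace ℂ (Fin M) →ₗ[ℂ] EuclideanSpace ℂ (Fin N)}
    {D : EuclideanSpace ℂ (Fin N) →ₗ[ℂ] EuclideanSpace ℂ (Fin N)} {z : ℂ}
    (hD : ∀ u, u = z • D u → u = 0)
    (hΦ : ∀ v u, u = C v + z • D u → act (ratMat Φ z) v = A v + z • B u)
    {k : EuclideanSpace ℂ (Fin N) →ₗ[ℂ] EuclideanSpace ℂ (Fin M)}
    (hk : ∀ u, k u = B u + z • k (D u)) (v : EuclideanSpace ℂ (Fin M)) :
    A v + z • k (C v) = act (ratMat Φ z) v := by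
  obtain ⟨u, hu⟩ := exists_state hD (C v)
  have h1 : k u = k (C v) + z • k (D u) := by
    conv_lhs => rw [hu, map_add, map_smul]
  have h2 : k (C v) = B u := add_right_cancel (h1.symm.trans (hk u))
  rw [hΦ v u hu, h2]

/-! ### Polynomials in two operators -/

theorem polyEval_map {A B : Type*} [Ring A] [Algebra ℂ A] [Ring B] [Algebra ℂ B] (g : A →ₐ[ℂ] B)
    (q : MvPolynomial (Fin 2) ℂ) (a b : A) : polyEval q (g a) (g b) = g (polyEval q a b) := by
  simp [polyEval]

theorem polyEval_intertwine {X Y : Type*} [NormedAddCommGroup X] [NormedSpace ℂ X]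
    [NormedAddCommGroup Y] [NormedSpace ℂ Y] {L : X →L[ℂ] Y} {a b : X →L[ℂ] X} {a' b' : Y →L[ℂ] Y}
    (ha : ∀ x, L (a x) = a' (L x)) (hb : ∀ x, L (b x) = b' (L x))
    (q : MvPolynomial (Fin 2) ℂ) (x : X) : L (polyEval q a b x) = polyEval q a' b' (L x) := by
  have hpow : ∀ {c : X →L[ℂ] X} {c' : Y →L[ℂ] Y}, (∀ x, L (c x) = c' (L x)) →
      ∀ n x, L ((c ^ n) x) = (c' ^ n) (L x) := by
    intro c c' hc n
    induction n with
    | zero => simp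
    | succ n ih => intro x; simp only [pow_succ', mul_apply_eq_comp, hc, ih]
  simp only [polyEval, sum_apply, smul_apply, map_sum,
    map_smul, mul_apply_eq_comp, hpow ha, hpow hb]

theorem IsL2Mul.mul {M : ℕ} {F G : ℂ → Matrix (Fin M) (Fin M) ℂ} {J K : L2 M →L[ℂ] L2 M}
    (hF : IsL2Mul F J) (hG : IsL2Mul G K) : IsL2Mul (fun z => F z * G z) (J * K) := by
  intro f
  filter_upwards [hF (K f), hG f] with t h1 h2
  rw [act_mul, ← h2, ← h1]
  rfl

theorem IsL2Mul.one {M : ℕ} : IsL2Mul (M := M) (fun _ => 1) 1 := fun f =>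
  ae_of_all _ fun t => by simp [act]

theorem IsL2Mul.pow {M : ℕ} {F : ℂ → Matrix (Fin M) (Fin M) ℂ} {J : L2 M →L[ℂ] L2 M}
    (hF : IsL2Mul F J) (n : ℕ) : IsL2Mul (fun z => F z ^ n) (J ^ n) := by
  induction n with
  | zero => simpa using IsL2Mul.one
  | succ n ih => simpa only [pow_succ] using ih.mul hF

theorem IsL2Mul.smul {M : ℕ} {F : ℂ → Matrix (Fin M) (Fin M) ℂ} {J : L2 M →L[ℂ] L2 M}
    (hF : IsL2Mul F J) (c : ℂ) : IsL2Mul (fun z => c • F z) (c • J) := by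
  intro f
  filter_upwards [hF f, Lp.coeFn_smul c (J f)] with t h1 h2
  rw [smul_apply, h2, Pi.smul_apply, h1]
  simp [act_eq_toLpLin]

theorem IsL2Mul.sum {M : ℕ} {α : Type*} {s : Finset α} {F : α → ℂ → Matrix (Fin M) (Fin M) ℂ}
    {J : α → L2 M →L[ℂ] L2 M} (hF : ∀ i, IsL2Mul (F i) (J i)) :
    IsL2Mul (fun z => ∑ i ∈ s, F i z) (∑ i ∈ s, J i) := by
  classical
  induction s using Finset.induction_on with
  | empty =>
    intro f
    filter_upwards [Lp.coeFn_zero (EuclideanSpace ℂ (Fin M)) 2 circMeas] with t ht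
    rw [Finset.sum_empty, zero_apply, ht]
    simp [act_eq_toLpLin]
  | insert i s hi ih =>
    intro f
    filter_upwards [hF i f, ih f, Lp.coeFn_add (J i f) ((∑ j ∈ s, J j) f)] with t h1 h2 h3
    rw [Finset.sum_insert hi, add_apply, h3, Pi.add_apply, h1, h2,
      Finset.sum_insert hi]
    simp only [act_eq_toLpLin, map_add, LinearMap.add_apply]

theorem IsL2Mul.polyEval {M : ℕ} {F G : ℂ → Matrix (Fin M) (Fin M) ℂ} {J K : L2 M →L[ℂ] L2 M}
    (hF : IsL2Mul F J) (hG : IsL2Mul G K) (q : MvPolynomial (Fin 2) ℂ) :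
    IsL2Mul (fun z => Isopair.polyEval q (F z) (G z)) (Isopair.polyEval q J K) :=
  IsL2Mul.sum fun m => ((hF.pow (m 0)).mul (hG.pow (m 1))).smul (q.coeff m)

theorem IsL2Mul.commute {M : ℕ} {F : ℂ → Matrix (Fin M) (Fin M) ℂ} {J K : L2 M →L[ℂ] L2 M}
    (hJ : IsL2Mul (coordFun M) J) (hK : IsL2Mul F K) : Commute J K := by
  ext1 f
  apply Lp.ext
  filter_upwards [hJ.mul hK f, hK.mul hJ f] with t h1 h2
  rw [h1, h2, act_mul, act_mul, act_coordFun, act_coordFun, act_smul]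

/-! ### The functional model -/

theorem continuous_pt : Continuous pt :=
  continuous_subtype_val.comp AddCircle.continuous_toCircle

theorem norm_pt (t : Circ) : ‖pt t‖ = 1 := Circle.norm_coe _

theorem IsL2Mul.monomialL2_succ {M : ℕ} {J : L2 M →L[ℂ] L2 M} (hJ : IsL2Mul (coordFun M) J)
    (n : ℤ) (v : EuclideanSpace ℂ (Fin M)) : J (monomialL2 n v) = monomialL2 (n + 1) v := by
  apply Lp.ext
  filter_upwards [hJ (monomialL2 n v), coeFn_monomialL2 n v, coeFn_monomialL2 (n + 1) v]
    with t h1 h2 h3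
  rw [h1, h2, h3, act_coordFun, smul_smul, fourier_add, fourier_one, mul_comm]
  rfl

section Model

variable {H : Type*} [NormedAddCommGroup H] [InnerProductSpace ℂ H] [CompleteSpace H]
  {Y : Type*} [NormedAddCommGroup Y] [NormedSpace ℂ Y]
  {M : ℕ} {S T : H →L[ℂ] H} {ι : EuclideanSpace ℂ (Fin M) →ₗᵢ[ℂ] H}

theorem ext_wandering (hS : IsPureIsometry S)
    (hι : ∀ x, ContinuousLinearMap.adjoint S x = 0 ↔ ∃ v, ι v = x) {L L' : H →L[ℂ] Y}
    (h : ∀ n v, L ((S ^ n) (ι v)) = L' ((S ^ n) (ι v))) : L = L' := by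
  obtain ⟨b, hb⟩ := exists_wold_basis hS hι
  refine ContinuousLinearMap.ext_on
    (Submodule.dense_iff_topologicalClosure_eq_top.2 b.dense_span) ?_
  rintro _ ⟨k, rfl⟩
  rw [hb, h]

/-- An operator that intertwines `S` with `R` also intertwines `T` with `Q`, where `Q` commutes
with `R`, as soon as it does so on the wandering subspace of `S`. -/
theorem intertwine_of_wandering (hS : IsPureIsometry S)
    (hι : ∀ x, ContinuousLinearMap.adjoint S x = 0 ↔ ∃ v, ι v = x) (hST : Commute S T)
    {θ : H →L[ℂ] Y} {R Q : Y →L[ℂ] Y} (hRQ : Commute R Q) (hθS : ∀ x, θ (S x) = R (θ x))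
    (hθT : ∀ v, θ (T (ι v)) = Q (θ (ι v))) (x : H) : θ (T x) = Q (θ x) := by
  have h : θ ∘L T = Q ∘L θ := by
    refine ext_wandering hS hι fun n v => ?_
    change θ (T ((S ^ n) (ι v))) = Q (θ ((S ^ n) (ι v)))
    induction n with
    | zero => exact hθT v
    | succ n ih =>
      rw [pow_succ', mul_apply_eq_comp, hθS]
      have h1 : ∀ y, T (S y) = S (T y) := fun y => (DFunLike.congr_fun hST.eq y).symm
      have h2 : ∀ y, R (Q y) = Q (R y) := fun y => DFunLike.congr_fun hRQ.eq y
      rw [h1, hθS, ih, h2]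
  exact DFunLike.congr_fun h x

/-- The unitary from `H` onto the Hardy space sending `Sⁿ ι(v)` to `zⁿ v`. -/
theorem exists_unitary_hardy (hS : IsPureIsometry S)
    (hι : ∀ x, ContinuousLinearMap.adjoint S x = 0 ↔ ∃ v, ι v = x) :
    ∃ U : H ≃ₗᵢ[ℂ] Hardy M, ∀ n v, U ((S ^ n) (ι v)) = monomialHardy n v := by
  obtain ⟨b, hb⟩ := exists_wold_basis hS hι
  refine ⟨b.repr.trans (hardyBasis M).repr.symm, fun n v => ?_⟩
  set U : H ≃ₗᵢ[ℂ] Hardy M := b.repr.trans (hardyBasis M).repr.symm with hU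
  have hUb : ∀ k, U (b k) = hardyBasis M k := fun k => by
    classical
    rw [hU, LinearIsometryEquiv.trans_apply, HilbertBasis.repr_self, HilbertBasis.repr_symm_single]
  have h : (Hardy M).subtype ∘ₗ U.toLinearEquiv.toLinearMap ∘ₗ (S ^ n).toLinearMap ∘ₗ
      ι.toLinearMap = monomialL2 (n : ℤ) := by
    refine (EuclideanSpace.basisFun (Fin M) ℂ).toBasis.ext fun i => ?_
    have := hUb (n, i)
    rw [hb, hardyBasis_apply] at this
    rw [OrthonormalBasis.coe_toBasis]
    exact congrArg Subtype.val this
  exact Subtype.ext (DFunLike.congr_fun h v)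

end Model

/-- On the wandering subspace, the model of `T` on the circle is multiplication by the transfer
function: for almost every `t` the vectors `κ(u)` are represented by a solution of
`k = B + e^{it} k D`. -/
theorem model_apply_wandering {H : Type*} [NormedAddCommGroup H] [InnerProductSpace ℂ H]
    {M N : ℕ} {S T : H →L[ℂ] H} {ι : EuclideanSpace ℂ (Fin M) →ₗᵢ[ℂ] H}
    {κ : EuclideanSpace ℂ (Fin N) →ₗᵢ[ℂ] H} {Φ : Matrix (Fin M) (Fin M) (RatFunc ℂ)}
    {A : EuclideanSpace ℂ (Fin M) →ₗ[ℂ] EuclideanSpace ℂ (Fin M)}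
    {B : EuclideanSpace ℂ (Fin N) →ₗ[ℂ] EuclideanSpace ℂ (Fin M)}
    {C : EuclideanSpace ℂ (Fin M) →ₗ[ℂ] EuclideanSpace ℂ (Fin N)}
    {D : EuclideanSpace ℂ (Fin N) →ₗ[ℂ] EuclideanSpace ℂ (Fin N)}
    (hD : ∀ z : ℂ, ‖z‖ ≤ 1 → ∀ u, u = z • D u → u = 0)
    (hΦ : ∀ z : ℂ, ‖z‖ ≤ 1 → ∀ v u, u = C v + z • D u → act (ratMat Φ z) v = A v + z • B u)
    (hT : ∀ v, T (ι v) = ι (A v) + S (κ (C v))) (hκ : ∀ u, κ u = ι (B u) + S (κ (D u)))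
    {θ : H →L[ℂ] L2 M} {Jz JΦ : L2 M →L[ℂ] L2 M} (hJz : IsL2Mul (coordFun M) Jz)
    (hJΦ : IsL2Mul (ratMat Φ) JΦ) (hθS : ∀ x, θ (S x) = Jz (θ x))
    (hθι : ∀ v, θ (ι v) = monomialL2 0 v) (v : EuclideanSpace ℂ (Fin M)) :
    θ (T (ι v)) = JΦ (θ (ι v)) := by
  have hconst : ∀ w, ∀ᵐ t ∂circMeas, θ (ι w) t = w := fun w => by
    rw [hθι]
    filter_upwards [coeFn_monomialL2 0 w] with t ht
    rw [ht, fourier_zero, one_smul]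
  have hstep : ∀ w u, ∀ᵐ t ∂circMeas, θ (ι w + S (κ u)) t = w + pt t • θ (κ u) t := fun w u => by
    rw [map_add, hθS]
    filter_upwards [Lp.coeFn_add (θ (ι w)) (Jz (θ (κ u))), hconst w, hJz (θ (κ u))] with t h1 h2 h3
    rw [h1, Pi.add_apply, h2, h3, act_coordFun]
  let bas := (EuclideanSpace.basisFun (Fin N) ℂ).toBasis
  let k : Circ → EuclideanSpace ℂ (Fin N) →ₗ[ℂ] EuclideanSpace ℂ (Fin M) := fun t =>
    bas.constr ℂ fun j => θ (κ (bas j)) t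
  have hk : ∀ u, ∀ᵐ t ∂circMeas, θ (κ u) t = k t u := fun u => by
    have hu : θ (κ u) = ∑ j, bas.repr u j • θ (κ (bas j)) := by
      conv_lhs => rw [← bas.sum_repr u]
      simp only [map_sum, map_smul]
    have hs : ∀ᵐ t ∂circMeas, ∀ j, (bas.repr u j • θ (κ (bas j)) : L2 M) t =
        bas.repr u j • θ (κ (bas j)) t :=
      ae_all_iff.2 fun j => Lp.coeFn_smul _ _
    rw [hu]
    filter_upwards [hs, Lp.coeFn_finsetSum Finset.univ fun j => bas.repr u j • θ (κ (bas j))]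
      with t h1 h2
    rw [h2, Finset.sum_apply, Module.Basis.constr_apply_fintype]
    exact Finset.sum_congr rfl fun j _ => h1 j
  have hkeq : ∀ᵐ t ∂circMeas, ∀ u, k t u = B u + pt t • k t (D u) := by
    have h : ∀ᵐ t ∂circMeas, ∀ j, k t (bas j) = B (bas j) + pt t • k t (D (bas j)) := by
      refine ae_all_iff.2 fun j => ?_
      filter_upwards [hk (bas j), hk (D (bas j)), hstep (B (bas j)) (D (bas j))] with t h1 h2 h3
      rw [← h1, ← h2, ← h3, ← hκ]
    filter_upwards [h] with t ht u
    have : k t = B + pt t • (k t ∘ₗ D) := bas.ext ht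
    exact DFunLike.congr_fun this u
  apply Lp.ext
  rw [hT v]
  filter_upwards [hstep (A v) (C v), hk (C v), hkeq, hJΦ (θ (ι v)), hconst v] with t h1 h2 h3 h4 h5
  rw [h1, h2, h4, h5]
  exact act_ratMat_eq (hD _ (norm_pt t).le) (hΦ _ (norm_pt t).le) h3 v

/-! ### Assembly of the model -/

theorem exists_unitary_isL2Mul {M : ℕ} {F : ℂ → Matrix (Fin M) (Fin M) ℂ}
    (hF : Continuous fun t => F (pt t))
    (hiso : ∀ z : ℂ, ‖z‖ = 1 → ∀ v, ‖act (F z) v‖ = ‖v‖) :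
    ∃ J ∈ unitary (L2 M →L[ℂ] L2 M), IsL2Mul F J :=
  ⟨_, mulL2_mem_unitary _ hF fun t => hiso _ (norm_pt t),
    coeFn_mulL2 _ hF fun t => hiso _ (norm_pt t)⟩

theorem isInner_ratMat {M : ℕ} {Φ : Matrix (Fin M) (Fin M) (RatFunc ℂ)}
    (hΦ : PolesInExterior Φ)
    (hle : ∀ z : ℂ, ‖z‖ ≤ 1 → ∀ v, ‖act (ratMat Φ z) v‖ ≤ ‖v‖)
    (hnorm : ∀ z : ℂ, ‖z‖ = 1 → ∀ v, ‖act (ratMat Φ z) v‖ = ‖v‖) :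
    IsInner (ratMat Φ) where
  analytic i j z hz :=
    (differentiableAt_ratMat hΦ (mem_ball_zero_iff.1 hz).le i j).differentiableWithinAt
  contractive z hz := hle z hz.le
  unitary_boundary := ae_of_all _ fun t => by
    refine ⟨_, mem_unitaryGroup_of_norm_act (hnorm _ (norm_pt t)),
      (continuousAt_ratMat hΦ (norm_pt t).le).tendsto.comp ?_⟩
    have h : Continuous fun r : ℝ => (r : ℂ) * pt t := by fun_prop
    have h1 := h.tendsto 1
    rw [Complex.ofReal_one, one_mul] at h1
    exact h1.mono_left nhdsWithin_le_nhds

theorem continuousOn_polyEval {X : Type*} [TopologicalSpace X] {M : ℕ}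
    {F G : X → Matrix (Fin M) (Fin M) ℂ} {s : Set X} (hF : ContinuousOn F s)
    (hG : ContinuousOn G s) (q : MvPolynomial (Fin 2) ℂ) :
    ContinuousOn (fun z => polyEval q (F z) (G z)) s := by
  unfold polyEval
  exact continuousOn_finsetSum _ fun m _ =>
    ((hF.pow (m 0)).mul (hG.pow (m 1))).const_smul (q.coeff m)

end Isopair

theorem theorem1p1 {H : Type*} [NormedAddCommGroup H] [InnerProductSpace ℂ H] [CompleteSpace H]
    (p : MvPolynomial (Fin 2) ℂ) (S T : H →L[ℂ] H) (M N : ℕ)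
    (hV : Isopair.IsPureIsopair p S T)
    (hMN : Isopair.bimult S T = ((M : Cardinal), (N : Cardinal))) :
    ∃ Φ : Matrix (Fin M) (Fin M) (RatFunc ℂ),
      Isopair.IsInner (Isopair.ratMat Φ) ∧ Isopair.PolesInExterior Φ ∧
      ∃ (Mz MΦ : Isopair.Hardy M →L[ℂ] Isopair.Hardy M)
        (Jz JΦ : Isopair.L2 M →L[ℂ] Isopair.L2 M),
        Isopair.IsHardyMul (Isopair.coordFun M) Mz ∧
        Isopair.IsHardyMul (Isopair.ratMat Φ) MΦ ∧
        Isopair.IsL2Mul (Isopair.coordFun M) Jz ∧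
        Isopair.IsL2Mul (Isopair.ratMat Φ) JΦ ∧
        -- unitary equivalence of `(S, T)` and `(Mz, MΦ)`
        (∃ U : H ≃ₗᵢ[ℂ] Isopair.Hardy M,
          (∀ x, U (S x) = Mz (U x)) ∧ (∀ x, U (T x) = MΦ (U x))) ∧
        Isopair.polyEval p Mz MΦ = 0 ∧
        -- commuting unitaries
        (Commute Jz JΦ ∧ Jz ∈ unitary (Isopair.L2 M →L[ℂ] Isopair.L2 M) ∧
          JΦ ∈ unitary (Isopair.L2 M →L[ℂ] Isopair.L2 M)) ∧
        -- restriction to the Hardy space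
        (∀ f : Isopair.Hardy M, Jz (f : Isopair.L2 M) = (Mz f : Isopair.L2 M) ∧
          JΦ (f : Isopair.L2 M) = (MΦ f : Isopair.L2 M)) ∧
        (∀ z : ℂ, ‖z‖ ≤ 1 →
          Isopair.polyEval p (Isopair.coordFun M z) (Isopair.ratMat Φ z) = 0) ∧
        Isopair.polyEval p Jz JΦ = 0 := by
  have hpS := hV.pure_left
  have hSi := hpS.isometry
  have hpST : ∀ x, Isopair.polyEval p S T x = 0 := fun x => by rw [hV.annihilated]; rfl
  obtain ⟨ι, hι⟩ := Isopair.exists_isometry_onto_ker_adjoint (congrArg Prod.fst hMN)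
  obtain ⟨κ, hκ⟩ := Isopair.exists_isometry_onto_ker_adjoint (congrArg Prod.snd hMN)
  obtain ⟨A, B, C, D, hT, hκS, hiso⟩ :=
    Isopair.exists_colligation hSi hV.pure_right.isometry hV.commute hι hκ
  -- `κ D = S* κ`, and `S*` has no eigenvalue outside the open disk
  have hD : ∀ z : ℂ, ‖z‖ ≤ 1 → ∀ u, u = z • D u → u = 0 := by
    intro z hz u hu
    have h1 : ContinuousLinearMap.adjoint S (κ u) = κ (D u) := by
      rw [hκS u, map_add, (hι _).2 ⟨B u, rfl⟩, zero_add, Isopair.adjoint_apply_of_isometry hSi]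
    have h2 : κ u = z • ContinuousLinearMap.adjoint S (κ u) := by
      rw [h1, ← map_smul, ← hu]
    exact κ.injective ((Isopair.eq_zero_of_eq_smul_adjoint hpS hz h2).trans (map_zero κ).symm)
  obtain ⟨Φ, hpoles, hΦ⟩ := Isopair.exists_transferFunction_linearMap A B C D hD
  have hle : ∀ z : ℂ, ‖z‖ ≤ 1 → ∀ v, ‖Isopair.act (Isopair.ratMat Φ z) v‖ ≤ ‖v‖ := by
    intro z hz v
    obtain ⟨c, hc, h⟩ := Isopair.norm_sq_act_ratMat (hD z hz) hiso (hΦ z hz) v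
    refine (sq_le_sq₀ (norm_nonneg _) (norm_nonneg _)).1 ?_
    have : (1 - ‖z‖ ^ 2) * c ≥ 0 :=
      mul_nonneg (sub_nonneg.2 (pow_le_one₀ (norm_nonneg _) hz)) hc
    linarith
  have hnorm : ∀ z : ℂ, ‖z‖ = 1 → ∀ v, ‖Isopair.act (Isopair.ratMat Φ z) v‖ = ‖v‖ := by
    intro z hz v
    obtain ⟨c, hc, h⟩ := Isopair.norm_sq_act_ratMat (hD z hz.le) hiso (hΦ z hz.le) v
    refine (sq_eq_sq₀ (norm_nonneg _) (norm_nonneg _)).1 ?_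
    rw [h, hz]
    ring
  have hcont : Continuous fun t => Isopair.ratMat Φ (Isopair.pt t) :=
    continuous_iff_continuousAt.2 fun t =>
      ContinuousAt.comp (g := Isopair.ratMat Φ)
        (Isopair.continuousAt_ratMat hpoles (Isopair.norm_pt t).le)
        Isopair.continuous_pt.continuousAt
  have hcoord : Continuous (Isopair.coordFun M) := by
    unfold Isopair.coordFun
    simp only [Matrix.scalar_apply]
    fun_prop
  obtain ⟨Jz, hJzu, hJz⟩ := Isopair.exists_unitary_isL2Mul
    (hcoord.comp Isopair.continuous_pt) fun z hz v => by
      rw [Isopair.act_coordFun, norm_smul, hz, one_mul]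
  obtain ⟨JΦ, hJΦu, hJΦ⟩ := Isopair.exists_unitary_isL2Mul hcont hnorm
  have hcomm : Commute Jz JΦ := hJz.commute hJΦ
  obtain ⟨U, hU⟩ := Isopair.exists_unitary_hardy hpS hι
  have hUι : ∀ v, U (ι v) = Isopair.monomialHardy 0 v := fun v => hU 0 v
  let Uc : H →L[ℂ] Isopair.Hardy M := U.toContinuousLinearEquiv
  let Ui : Isopair.Hardy M →L[ℂ] H := U.symm.toContinuousLinearEquiv
  let Mz := Uc ∘L S ∘L Ui
  let MΦ := Uc ∘L T ∘L Ui
  have hMz : ∀ x, U (S x) = Mz (U x) := fun x =>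
    congrArg (fun y => U (S y)) (U.symm_apply_apply x).symm
  have hMΦ : ∀ x, U (T x) = MΦ (U x) := fun x =>
    congrArg (fun y => U (T y)) (U.symm_apply_apply x).symm
  -- the model on the circle
  let θ : H →L[ℂ] Isopair.L2 M := (Isopair.Hardy M).subtypeL ∘L Uc
  have hθS : ∀ x, θ (S x) = Jz (θ x) := by
    have h : θ ∘L S = Jz ∘L θ := by
      refine Isopair.ext_wandering hpS hι fun n v => ?_
      change ((U (S ((S ^ n) (ι v))) : Isopair.Hardy M) : Isopair.L2 M) =
        Jz ((U ((S ^ n) (ι v)) : Isopair.Hardy M) : Isopair.L2 M)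
      rw [← mul_apply_eq_comp, ← pow_succ', hU, hU]
      exact (hJz.monomialL2_succ n v).symm
    exact fun x => DFunLike.congr_fun h x
  have hθT : ∀ x, θ (T x) = JΦ (θ x) := by
    refine Isopair.intertwine_of_wandering hpS hι hV.commute hcomm hθS ?_
    exact Isopair.model_apply_wandering hD hΦ hT hκS hJz hJΦ hθS
      fun v => congrArg Subtype.val (hUι v)
  -- the model on the disk
  have hdisc : ∀ z : ℂ, ‖z‖ < 1 → ∃ ε : H →L[ℂ] EuclideanSpace ℂ (Fin M),
      (∀ x, ε x = Isopair.discValue (U x) z) ∧ (∀ v, ε (ι v) = v) ∧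
      (∀ x, ε (S x) = Matrix.toEuclideanCLM (𝕜 := ℂ) (Isopair.coordFun M z) (ε x)) ∧
      ∀ x, ε (T x) = Matrix.toEuclideanCLM (𝕜 := ℂ) (Isopair.ratMat Φ z) (ε x) := by
    intro z hz
    obtain ⟨L, hL⟩ := Isopair.exists_discValue_clm M hz
    let ε := L ∘L Uc
    have hε : ∀ x, ε x = Isopair.discValue (U x) z := fun x => hL (U x)
    have hει : ∀ v, ε (ι v) = v := fun v => by
      rw [hε, hUι, Isopair.discValue_monomialHardy, pow_zero, one_smul]
    set Q := Matrix.toEuclideanCLM (𝕜 := ℂ) (Isopair.ratMat Φ z)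
    set R := Matrix.toEuclideanCLM (𝕜 := ℂ) (Isopair.coordFun M z)
    have hR : ∀ v, R v = z • v := Isopair.act_coordFun z
    have hRQ : Commute R Q := by
      ext1 v
      rw [mul_apply_eq_comp, mul_apply_eq_comp, hR, hR, map_smul]
    have hεS : ∀ x, ε (S x) = R (ε x) := by
      have h : ε ∘L S = R ∘L ε := by
        refine Isopair.ext_wandering hpS hι fun n v => ?_
        change ε (S ((S ^ n) (ι v))) = R (ε ((S ^ n) (ι v)))
        rw [← mul_apply_eq_comp, ← pow_succ', hε, hε, hU, hU, hR,
          Isopair.discValue_monomialHardy, Isopair.discValue_monomialHardy, smul_smul, pow_succ']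
      exact fun x => DFunLike.congr_fun h x
    refine ⟨ε, hε, hει, hεS,
      Isopair.intertwine_of_wandering hpS hι hV.commute hRQ hεS fun v => ?_⟩
    have hk := Isopair.act_ratMat_eq (hD z hz.le) (hΦ z hz.le)
      (k := ε.toLinearMap ∘ₗ κ.toLinearMap) (fun u => by
        change ε (κ u) = B u + z • ε (κ (D u))
        rw [hκS u, map_add, hει, hεS, hR]) v
    rw [hT, map_add, hει, hεS, hR, hει]
    exact hk
  have hinside : ∀ z : ℂ, ‖z‖ < 1 →
      Isopair.polyEval p (Isopair.coordFun M z) (Isopair.ratMat Φ z) = 0 := by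
    intro z hz
    obtain ⟨ε, -, hει, hεS, hεT⟩ := hdisc z hz
    apply (Matrix.toEuclideanCLM (n := Fin M) (𝕜 := ℂ)).injective
    rw [map_zero]
    have h := Isopair.polyEval_map
      ((Matrix.toEuclideanCLM (n := Fin M) (𝕜 := ℂ)).toAlgEquiv.toAlgHom) p
      (Isopair.coordFun M z) (Isopair.ratMat Φ z)
    refine h.symm.trans ?_
    ext1 v
    have h2 := Isopair.polyEval_intertwine hεS hεT p (ι v)
    rw [hpST, map_zero, hει] at h2
    exact h2.symm
  have hclosed : ∀ z : ℂ, ‖z‖ ≤ 1 →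
      Isopair.polyEval p (Isopair.coordFun M z) (Isopair.ratMat Φ z) = 0 := by
    have hc := Isopair.continuousOn_polyEval (s := Metric.closedBall (0 : ℂ) 1)
      hcoord.continuousOn (fun z hz => (Isopair.continuousAt_ratMat hpoles
        (mem_closedBall_zero_iff.1 hz)).continuousWithinAt) p
    have hzero : Set.EqOn
        (fun z => Isopair.polyEval p (Isopair.coordFun M z) (Isopair.ratMat Φ z)) 0
        (Metric.closedBall (0 : ℂ) 1) :=
      Set.EqOn.of_subset_closure (s := Metric.ball (0 : ℂ) 1)
        (fun z hz => hinside z (mem_ball_zero_iff.1 hz)) hc continuousOn_const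
        Metric.ball_subset_closedBall (closure_ball (0 : ℂ) one_ne_zero).ge
    exact fun z hz => hzero (mem_closedBall_zero_iff.2 hz)
  refine ⟨Φ, Isopair.isInner_ratMat hpoles hle hnorm, hpoles, Mz, MΦ, Jz, JΦ, ?_, ?_, hJz, hJΦ,
    ⟨U, hMz, hMΦ⟩, ?_, ⟨hcomm, hJzu, hJΦu⟩,
    fun f => ?_, hclosed, ?_⟩
  · intro f z hz
    obtain ⟨ε, hε, -, hεS, -⟩ := hdisc z hz
    obtain ⟨x, rfl⟩ := U.surjective f
    rw [← hMz, ← hε, ← hε, hεS]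
    rfl
  · intro f z hz
    obtain ⟨ε, hε, -, -, hεT⟩ := hdisc z hz
    obtain ⟨x, rfl⟩ := U.surjective f
    rw [← hMΦ, ← hε, ← hε, hεT]
    rfl
  · ext1 f
    obtain ⟨x, rfl⟩ := U.surjective f
    have h := Isopair.polyEval_intertwine (L := Uc) hMz hMΦ p x
    rw [hpST, map_zero] at h
    exact h.symm
  · obtain ⟨x, rfl⟩ := U.surjective f
    rw [← hMz, ← hMΦ]
    exact ⟨(hθS x).symm, (hθT x).symm⟩
  · ext1 f
    apply Lp.ext
    filter_upwards [hJz.polyEval hJΦ p f, Lp.coeFn_zero (EuclideanSpace ℂ (Fin M)) 2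
      Isopair.circMeas] with t h1 h2
    rw [h1, hclosed _ (Isopair.norm_pt t).le, zero_apply, h2]
    simp [Isopair.act]
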